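/- Let $d\ge 0$ be an integer and let $G$ be a finite simple $d$-regular graph. A $2$-dynamic $k$-coloring of $G$ is a proper vertex coloring with $k$ available colors in which the neighbors of every vertex $v$ receive at least $\min\{2,\deg(v)\}$ different colors; the dynamic chromatic number $\chi_2(G)$ is the least $k$ for which $G$ has such a coloring, and $\chi(G)$ is the chromatic number. Write $\log$ for the natural logarithm and $e$ for its base. Then $$\chi_2(G)\le \chi(G)+\lceil e\log(d^2+1)+e\rceil .$$ Moreover, if $d\ge 3$, then $$\lceil e\log(d^2+1)+e\rceil\le\lceil 5.437\log d+2.721\rceil,$$ hence $\chi_2(G)\le\chi(G)+\lceil 5.437\log d+2.721\rceil$, and this improves Alishahi's bound $\chi_2(G)\le\chi(G)+14.06\log d+1$ in the sense that $$\lceil 5.437\log d+2.721\rceil<14.06\log d+1 .$$ -/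

import Mathlib

namespace SimpleGraph

/-- A proper coloring `C` of a locally finite graph `G` is `r`-dynamic if the neighbors of every
vertex `v` receive at least `min {r, deg v}` different colors. -/
def Coloring.IsDynamic {V α : Type*} [DecidableEq α] {G : SimpleGraph V} [G.LocallyFinite]
    (C : G.Coloring α) (r : ℕ) : Prop :=
  ∀ v : V, min r (G.degree v) ≤ ((G.neighborFinset v).image C).card

/-- `G` admits an `r`-dynamic `k`-coloring. -/
def DynamicColorable {V : Type*} (G : SimpleGraph V) [G.LocallyFinite] (r k : ℕ) : Prop :=
  ∃ C : G.Coloring (Fin k), C.IsDynamic r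

/-- The `r`-dynamic chromatic number: the least `k` such that `G` admits an `r`-dynamic
`k`-coloring (and `⊤` if there is no such `k`), as for `SimpleGraph.chromaticNumber`. -/
noncomputable def dynamicChromaticNumber {V : Type*} (G : SimpleGraph V) [G.LocallyFinite]
    (r : ℕ) : ℕ∞ :=
  ⨅ k ∈ {k : ℕ | G.DynamicColorable r k}, (k : ℕ∞)

end SimpleGraph

/-! Let `k = ⌈e log(d² + 1) + e⌉`. Suppose a vertex set `T` meets every neighborhood, contains none,
and induces maximum degree less than `k`. Recoloring `T` greedily with `k` new colors then keeps the
coloring proper and shows every vertex both an old and a new color (`dynamicColorable_two_add`).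

For `d ≥ 9` such a `T` comes from the local lemma: put each vertex in `T` independently with
probability `p`. The bad event at `v` depends only on the closed neighborhood of `v`, hence
interacts with at most `d²` others, so probability at most `1 / (e(d² + 1))` suffices. If `k < d`,
take `p = k / (ed)`: the degree threshold is `e` times the mean `pd`, the Chernoff term is `p
e^{-pd}`, and the three failure probabilities sum to at most `e^{-pd} = e^{-k/e}`, which is where
the value of `k` comes from. If `d ≤ k`, the degree condition is free and `p = 1/2` works.

For `2 ≤ d ≤ 8` there are at least `2d + 1` colors, enough for local recoloring; for `d ≤ 1` every
proper coloring is 2-dynamic. -/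

/-! ### Numerical bounds on logarithms and ceilings -/

theorem Real.div_lt_log_of_pow_le {n a b : ℕ} (hb : 0 < b) (h : (2.7182818286 : ℝ) ^ a ≤ n ^ b)
    (ha : a ≠ 0) : (a / b : ℝ) < Real.log n := by
  have hlt : Real.exp a < (n : ℝ) ^ b := by
    rw [← Real.exp_one_pow]
    exact (pow_lt_pow_left₀ Real.exp_one_lt_d9 (Real.exp_pos 1).le ha).trans_le h
  have hlog := (Real.lt_log_iff_exp_lt ((Real.exp_pos _).trans hlt)).2 hlt
  rw [Real.log_pow] at hlog
  rw [div_lt_iff₀ (by exact_mod_cast hb)]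
  linarith

theorem Real.log_lt_div_of_le_pow {n a b : ℕ} (hn : 0 < n) (hb : 0 < b)
    (h : (n : ℝ) ^ b ≤ (2.7182818283 : ℝ) ^ a) (ha : a ≠ 0) : Real.log n < (a / b : ℝ) := by
  have hlt : (n : ℝ) ^ b < Real.exp a := by
    rw [← Real.exp_one_pow]
    exact h.trans_lt (pow_lt_pow_left₀ Real.exp_one_gt_d9 (by norm_num) ha)
  have hlog := (Real.log_lt_iff_lt_exp (by positivity)).2 hlt
  rw [Real.log_pow] at hlog
  rw [lt_div_iff₀ (by exact_mod_cast hb)]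
  linarith

/-- An integer `m` separates the ceilings: the left argument is at most `m`, and the right one
exceeds `m - 1`. The fractions `a/b` and `a'/b'` are rational bounds for `log (d² + 1)` and `log d`.
-/
theorem ceil_exp_one_mul_log_le_of_bounds {d a b a' b' m : ℕ} (hb : 0 < b) (hb' : 0 < b')
    (ha : a ≠ 0) (ha' : a' ≠ 0)
    (h : ((d ^ 2 + 1 : ℕ) : ℝ) ^ b ≤ (2.7182818283 : ℝ) ^ a)
    (h' : (2.7182818286 : ℝ) ^ a' ≤ (d : ℝ) ^ b')
    (hm : 2.7182818286 * (a / b + 1 : ℝ) ≤ m) (hm' : (m : ℝ) - 1 ≤ 5.437 * (a' / b') + 2.721) :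
    ⌈Real.exp 1 * Real.log ((d : ℝ) ^ 2 + 1) + Real.exp 1⌉₊ ≤
      ⌈(5.437 : ℝ) * Real.log d + 2.721⌉₊ := by
  have h₁ := Real.log_lt_div_of_le_pow (Nat.succ_pos _) hb h ha
  have h₂ := Real.div_lt_log_of_pow_le hb' h' ha'
  push_cast at h₁
  calc _ ≤ m := by
        rw [Nat.ceil_le]
        have : 0 ≤ (a / b : ℝ) := by positivity
        nlinarith [Real.exp_one_lt_d9, Real.exp_pos 1]
    _ ≤ _ := by
        by_contra! hlt
        have : ⌈(5.437 : ℝ) * Real.log d + 2.721⌉₊ ≤ m - 1 := by omega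
        rw [Nat.ceil_le] at this
        have hm0 : 1 ≤ m := by omega
        push_cast [hm0] at this
        linarith

-- The arguments of the ceilings compare directly only for large `d`, once the slack in the
-- constants absorbs `e log(1 + 1/d²)`; smaller `d` need the rounding.
set_option exponentiation.threshold 2000 in
theorem ceil_exp_one_mul_log_le {d : ℕ} (hd : 3 ≤ d) :
    ⌈Real.exp 1 * Real.log ((d : ℝ) ^ 2 + 1) + Real.exp 1⌉₊ ≤
      ⌈(5.437 : ℝ) * Real.log d + 2.721⌉₊ := by
  rcases le_or_gt 26 d with h | h
  · apply Nat.ceil_le_ceil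
    have hd0 : (26 : ℝ) ≤ d := by exact_mod_cast h
    have hlog : (13 / 4 : ℝ) ≤ Real.log d := by
      have h26 := Real.div_lt_log_of_pow_le (n := 26) (a := 13) (b := 4) (by norm_num)
        (by norm_num) (by norm_num)
      push_cast at h26
      exact h26.le.trans (Real.log_le_log (by norm_num) hd0)
    have hsplit : Real.log ((d : ℝ) ^ 2 + 1) ≤ 2 * Real.log d + 1 / 676 := by
      have : (d : ℝ) ^ 2 + 1 = d ^ 2 * (1 + 1 / d ^ 2) := by field_simp
      rw [this, Real.log_mul (by positivity) (by positivity), Real.log_pow]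
      have h₁ := Real.log_le_sub_one_of_pos (x := 1 + 1 / (d : ℝ) ^ 2) (by positivity)
      have h₂ : 1 / (d : ℝ) ^ 2 ≤ 1 / 676 := by
        apply one_div_le_one_div_of_le (by norm_num); nlinarith
      push_cast
      linarith
    -- The margin is thin: `(5.437 - 2e) · 13/4 + (2.721 - e) ≈ 0.00414`, against `e/676 ≈ 0.00402`.
    nlinarith [Real.exp_one_lt_d9, Real.exp_pos 1]
  · interval_cases d
    · exact ceil_exp_one_mul_log_le_of_bounds (a := 30) (b := 13) (a' := 1) (b' := 1) (m := 9)
        (by norm_num) (by norm_num) (by norm_num) (by norm_num) (by norm_num) (by norm_num)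
        (by norm_num) (by norm_num)
    · exact ceil_exp_one_mul_log_le_of_bounds (a := 3) (b := 1) (a' := 11) (b' := 8) (m := 11)
        (by norm_num) (by norm_num) (by norm_num) (by norm_num) (by norm_num) (by norm_num)
        (by norm_num) (by norm_num)
    · exact ceil_exp_one_mul_log_le_of_bounds (a := 10) (b := 3) (a' := 8) (b' := 5) (m := 12)
        (by norm_num) (by norm_num) (by norm_num) (by norm_num) (by norm_num) (by norm_num)
        (by norm_num) (by norm_num)
    · exact ceil_exp_one_mul_log_le_of_bounds (a := 11) (b := 3) (a' := 7) (b' := 4) (m := 13)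
        (by norm_num) (by norm_num) (by norm_num) (by norm_num) (by norm_num) (by norm_num)
        (by norm_num) (by norm_num)
    · exact ceil_exp_one_mul_log_le_of_bounds (a := 4) (b := 1) (a' := 19) (b' := 10) (m := 14)
        (by norm_num) (by norm_num) (by norm_num) (by norm_num) (by norm_num) (by norm_num)
        (by norm_num) (by norm_num)
    · exact ceil_exp_one_mul_log_le_of_bounds (a := 9) (b := 2) (a' := 27) (b' := 13) (m := 15)
        (by norm_num) (by norm_num) (by norm_num) (by norm_num) (by norm_num) (by norm_num)
        (by norm_num) (by norm_num)
    · exact ceil_exp_one_mul_log_le_of_bounds (a := 9) (b := 2) (a' := 13) (b' := 6) (m := 15)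
        (by norm_num) (by norm_num) (by norm_num) (by norm_num) (by norm_num) (by norm_num)
        (by norm_num) (by norm_num)
    · exact ceil_exp_one_mul_log_le_of_bounds (a := 14) (b := 3) (a' := 16) (b' := 7) (m := 16)
        (by norm_num) (by norm_num) (by norm_num) (by norm_num) (by norm_num) (by norm_num)
        (by norm_num) (by norm_num)
    · exact ceil_exp_one_mul_log_le_of_bounds (a := 29) (b := 6) (a' := 7) (b' := 3) (m := 16)
        (by norm_num) (by norm_num) (by norm_num) (by norm_num) (by norm_num) (by norm_num)
        (by norm_num) (by norm_num)
    · exact ceil_exp_one_mul_log_le_of_bounds (a := 5) (b := 1) (a' := 22) (b' := 9) (m := 17)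
        (by norm_num) (by norm_num) (by norm_num) (by norm_num) (by norm_num) (by norm_num)
        (by norm_num) (by norm_num)
    · exact ceil_exp_one_mul_log_le_of_bounds (a := 21) (b := 4) (a' := 5) (b' := 2) (m := 17)
        (by norm_num) (by norm_num) (by norm_num) (by norm_num) (by norm_num) (by norm_num)
        (by norm_num) (by norm_num)
    · exact ceil_exp_one_mul_log_le_of_bounds (a := 11) (b := 2) (a' := 29) (b' := 11) (m := 18)
        (by norm_num) (by norm_num) (by norm_num) (by norm_num) (by norm_num) (by norm_num)
        (by norm_num) (by norm_num)
    · exact ceil_exp_one_mul_log_le_of_bounds (a := 11) (b := 2) (a' := 8) (b' := 3) (m := 18)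
        (by norm_num) (by norm_num) (by norm_num) (by norm_num) (by norm_num) (by norm_num)
        (by norm_num) (by norm_num)
    · exact ceil_exp_one_mul_log_le_of_bounds (a := 28) (b := 5) (a' := 8) (b' := 3) (m := 18)
        (by norm_num) (by norm_num) (by norm_num) (by norm_num) (by norm_num) (by norm_num)
        (by norm_num) (by norm_num)
    · exact ceil_exp_one_mul_log_le_of_bounds (a := 23) (b := 4) (a' := 31) (b' := 11) (m := 19)
        (by norm_num) (by norm_num) (by norm_num) (by norm_num) (by norm_num) (by norm_num)
        (by norm_num) (by norm_num)
    · exact ceil_exp_one_mul_log_le_of_bounds (a := 29) (b := 5) (a' := 17) (b' := 6) (m := 19)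
        (by norm_num) (by norm_num) (by norm_num) (by norm_num) (by norm_num) (by norm_num)
        (by norm_num) (by norm_num)
    · exact ceil_exp_one_mul_log_le_of_bounds (a := 59) (b := 10) (a' := 17) (b' := 6) (m := 19)
        (by norm_num) (by norm_num) (by norm_num) (by norm_num) (by norm_num) (by norm_num)
        (by norm_num) (by norm_num)
    · exact ceil_exp_one_mul_log_le_of_bounds (a := 6) (b := 1) (a' := 509) (b' := 170) (m := 20)
        (by norm_num) (by norm_num) (by norm_num) (by norm_num) (by norm_num) (by norm_num)
        (by norm_num) (by norm_num)
    · exact ceil_exp_one_mul_log_le_of_bounds (a := 19) (b := 3) (a' := 3) (b' := 1) (m := 20)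
        (by norm_num) (by norm_num) (by norm_num) (by norm_num) (by norm_num) (by norm_num)
        (by norm_num) (by norm_num)
    · exact ceil_exp_one_mul_log_le_of_bounds (a := 19) (b := 3) (a' := 3) (b' := 1) (m := 20)
        (by norm_num) (by norm_num) (by norm_num) (by norm_num) (by norm_num) (by norm_num)
        (by norm_num) (by norm_num)
    · exact ceil_exp_one_mul_log_le_of_bounds (a := 19) (b := 3) (a' := 3) (b' := 1) (m := 20)
        (by norm_num) (by norm_num) (by norm_num) (by norm_num) (by norm_num) (by norm_num)
        (by norm_num) (by norm_num)
    -- At `d = 24` the right argument is about `20.0001`, barely above `m - 1`, hence the fine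
    -- approximation of `log 24`.
    · exact ceil_exp_one_mul_log_le_of_bounds (a := 13) (b := 2) (a' := 1071) (b' := 337) (m := 21)
        (by norm_num) (by norm_num) (by norm_num) (by norm_num) (by norm_num) (by norm_num)
        (by norm_num) (by norm_num)
    · exact ceil_exp_one_mul_log_le_of_bounds (a := 13) (b := 2) (a' := 16) (b' := 5) (m := 21)
        (by norm_num) (by norm_num) (by norm_num) (by norm_num) (by norm_num) (by norm_num)
        (by norm_num) (by norm_num)

theorem ceil_mul_log_lt {d : ℕ} (hd : 3 ≤ d) :
    (⌈(5.437 : ℝ) * Real.log d + 2.721⌉₊ : ℝ) < 14.06 * Real.log d + 1 := by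
  have h3 : (1 : ℝ) ≤ Real.log d := by
    rw [Real.le_log_iff_exp_le (by positivity)]
    have : (3 : ℝ) ≤ d := by exact_mod_cast hd
    linarith [Real.exp_one_lt_three]
  have := Nat.ceil_lt_add_one (a := (5.437 : ℝ) * Real.log d + 2.721) (by linarith)
  linarith

theorem le_exp_one_mul_log_of_pow_le {n a b : ℕ} (hb : 0 < b) (ha : a ≠ 0)
    (h : (2.7182818286 : ℝ) ^ a ≤ n ^ b) :
    2.718 * (a / b + 1 : ℝ) ≤ Real.exp 1 * Real.log n + Real.exp 1 := by
  have h₁ := Real.div_lt_log_of_pow_le hb h ha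
  have h₂ : 0 ≤ (a / b : ℝ) := by positivity
  nlinarith [Real.exp_one_gt_d9]

/-- With `χ ≥ 2` this gives `2d + 1` colors in total. It fails at `d = 9`, where the ceiling is
`15`. -/
theorem two_mul_le_ceil_add_one {d : ℕ} (hd : 2 ≤ d) (hd' : d ≤ 8) :
    2 * d ≤ ⌈Real.exp 1 * Real.log ((d : ℝ) ^ 2 + 1) + Real.exp 1⌉₊ + 1 := by
  suffices h : (2 * d - 2 : ℝ) <
      ⌈Real.exp 1 * Real.log ((d : ℝ) ^ 2 + 1) + Real.exp 1⌉₊ by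
    have : ((2 * d : ℕ) : ℝ) <
      (⌈Real.exp 1 * Real.log ((d : ℝ) ^ 2 + 1) + Real.exp 1⌉₊ + 2 : ℕ) := by
      push_cast; linarith
    have := Nat.cast_lt.1 this
    omega
  refine lt_of_lt_of_le ?_ (Nat.le_ceil _)
  interval_cases d
  · have := le_exp_one_mul_log_of_pow_le (n := 5) (a := 1) (b := 1) (by norm_num) (by norm_num)
      (by norm_num)
    norm_num at this ⊢
    linarith
  · have := le_exp_one_mul_log_of_pow_le (n := 10) (a := 1) (b := 1) (by norm_num) (by norm_num)
      (by norm_num)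
    norm_num at this ⊢
    linarith
  · have := le_exp_one_mul_log_of_pow_le (n := 17) (a := 2) (b := 1) (by norm_num) (by norm_num)
      (by norm_num)
    norm_num at this ⊢
    linarith
  · have := le_exp_one_mul_log_of_pow_le (n := 26) (a := 2) (b := 1) (by norm_num) (by norm_num)
      (by norm_num)
    norm_num at this ⊢
    linarith
  · have := le_exp_one_mul_log_of_pow_le (n := 37) (a := 3) (b := 1) (by norm_num) (by norm_num)
      (by norm_num)
    norm_num at this ⊢
    linarith
  · have := le_exp_one_mul_log_of_pow_le (n := 50) (a := 7) (b := 2) (by norm_num) (by norm_num)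
      (by norm_num)
    norm_num at this ⊢
    linarith
  · have := le_exp_one_mul_log_of_pow_le (n := 65) (a := 25) (b := 6) (by norm_num) (by norm_num)
      (by norm_num)
    norm_num at this ⊢
    linarith

/-! ### The local lemma on a finite weighted space -/

/-- The total weight of the set `A`. -/
noncomputable def weightOf {Ω : Type*} [Fintype Ω] (W : Ω → ℝ) (A : Set Ω) : ℝ :=
  ∑ ω, A.indicator W ω

section Weight

variable {Ω : Type*} [Fintype Ω] {W : Ω → ℝ}

theorem weightOf_mono (hW : ∀ ω, 0 ≤ W ω) {A B : Set Ω} (h : A ⊆ B) :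
    weightOf W A ≤ weightOf W B :=
  Finset.sum_le_sum fun ω _ => Set.indicator_le_indicator_of_subset h hW ω

theorem weightOf_inter_add_diff (A B : Set Ω) :
    weightOf W (A ∩ B) + weightOf W (A \ B) = weightOf W A := by
  classical
  simp only [weightOf, ← Finset.sum_add_distrib]
  refine Finset.sum_congr rfl fun ω _ => ?_
  by_cases hA : ω ∈ A <;> by_cases hB : ω ∈ B <;> simp [Set.indicator, hA, hB]

theorem weightOf_union_le (hW : ∀ ω, 0 ≤ W ω) (A B : Set Ω) :
    weightOf W (A ∪ B) ≤ weightOf W A + weightOf W B := by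
  classical
  simp only [weightOf, ← Finset.sum_add_distrib]
  refine Finset.sum_le_sum fun ω _ => ?_
  have := hW ω
  by_cases hA : ω ∈ A <;> by_cases hB : ω ∈ B <;> simp [Set.indicator, hA, hB, this]

theorem weightOf_le_sum_mul (hW : ∀ ω, 0 ≤ W ω) {A : Set Ω} {f : Ω → ℝ} (hf : ∀ ω, 0 ≤ f ω)
    (hA : ∀ ω ∈ A, 1 ≤ f ω) : weightOf W A ≤ ∑ ω, W ω * f ω := by
  refine Finset.sum_le_sum fun ω _ => ?_
  by_cases h : ω ∈ A
  · simpa [h] using le_mul_of_one_le_right (hW ω) (hA ω h)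
  · simpa [h] using mul_nonneg (hW ω) (hf ω)

/-- The symmetric **Lovász local lemma** on a finite weighted sample space. -/
theorem exists_forall_notMem_of_local_lemma {ι : Type*} [Fintype ι] [DecidableEq ι]
    (hW : ∀ ω, 0 ≤ W ω) (hpos : 0 < weightOf W Set.univ) (A : ι → Set Ω) (Γ : ι → Finset ι)
    {x : ℝ} (hx : 0 ≤ x) (hx1 : x < 1) {D : ℕ} (hΓ : ∀ i, (Γ i).card ≤ D)
    (hA : ∀ i, weightOf W (A i) ≤ x * (1 - x) ^ D)
    (hind : ∀ i (S : Finset ι), i ∉ S → Disjoint S (Γ i) →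
      weightOf W (A i ∩ {ω | ∀ j ∈ S, ω ∉ A j}) ≤
        weightOf W (A i) * weightOf W {ω | ∀ j ∈ S, ω ∉ A j}) :
    ∃ ω, ∀ i, ω ∉ A i := by
  set N : Finset ι → Set Ω := fun S => {ω | ∀ j ∈ S, ω ∉ A j} with hN
  have hnonneg (B : Set Ω) : 0 ≤ weightOf W B :=
    Finset.sum_nonneg fun ω _ => Set.indicator_nonneg (fun ω _ => hW ω) ω
  have hx' : 0 < 1 - x := by linarith
  -- This is `P(A i | N S) ≤ x`, multiplied out so that no conditioning on a null event occurs.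
  have key : ∀ S : Finset ι, ∀ i ∉ S,
      (1 - x) * weightOf W (N S) ≤ weightOf W (N (insert i S)) := by
    intro S
    induction S using Finset.strongInduction with
    | H S ih =>
      intro i hi
      -- Adding the events of `U` one at a time costs a factor `1 - x` each, by induction on proper
      -- subsets of `S`.
      have chain : ∀ U R : Finset ι, Disjoint R U → R ∪ U ⊆ S →
          (1 - x) ^ U.card * weightOf W (N R) ≤ weightOf W (N (R ∪ U)) := by
        intro U R
        induction U using Finset.induction with
        | empty => simp
        | insert a U ha ihU =>
          intro hd hs
          rw [Finset.disjoint_insert_right] at hd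
          have haS : a ∈ S := hs (by simp)
          have hsub : R ∪ U ⊆ S :=
            (Finset.union_subset_union_right (Finset.subset_insert _ _)).trans hs
          have hss : R ∪ U ⊂ S := by
            refine Finset.ssubset_iff_subset_ne.2 ⟨hsub, ?_⟩
            rintro rfl
            simp [ha, hd.1] at haS
          have h := ih _ hss a (by simp [ha, hd.1])
          rw [Finset.union_insert, Finset.card_insert_of_notMem ha, pow_succ']
          calc _ = (1 - x) * ((1 - x) ^ U.card * weightOf W (N R)) := by ring
            _ ≤ (1 - x) * weightOf W (N (R ∪ U)) :=
              mul_le_mul_of_nonneg_left (ihU hd.2 hsub) hx'.le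
            _ ≤ _ := h
      have h₁ : weightOf W (N (insert i S)) =
          weightOf W (N S) - weightOf W (N S ∩ A i) := by
        rw [← weightOf_inter_add_diff (W := W) (N S) (A i), add_sub_cancel_left]
        congr 1
        ext ω
        simp [hN, and_comm]
      -- Forgetting the conditions in `Γ i` leaves an event independent of `A i`; `chain` then
      -- restores them.
      have h₂ : weightOf W (N S ∩ A i) ≤ weightOf W (A i ∩ N (S \ Γ i)) := by
        apply weightOf_mono hW
        rintro ω ⟨h, h'⟩
        exact ⟨h', fun j hj => h j (Finset.mem_sdiff.1 hj).1⟩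
      have h₃ := hind i (S \ Γ i) (by simp [hi]) Finset.sdiff_disjoint
      have h₄ := chain (S ∩ Γ i) (S \ Γ i) (Finset.disjoint_sdiff_inter _ _)
        (by rw [Finset.sdiff_union_inter])
      rw [Finset.sdiff_union_inter] at h₄
      have h₅ : (1 - x) ^ D ≤ (1 - x) ^ (S ∩ Γ i).card :=
        pow_le_pow_of_le_one hx'.le (by linarith)
          ((Finset.card_le_card Finset.inter_subset_right).trans (hΓ i))
      have h₆ : weightOf W (A i ∩ N (S \ Γ i)) ≤ x * weightOf W (N S) :=
        calc _ ≤ weightOf W (A i) * weightOf W (N (S \ Γ i)) := h₃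
          _ ≤ (x * (1 - x) ^ D) * weightOf W (N (S \ Γ i)) :=
            mul_le_mul_of_nonneg_right (hA i) (hnonneg _)
          _ ≤ x * ((1 - x) ^ (S ∩ Γ i).card * weightOf W (N (S \ Γ i))) := by
            rw [mul_assoc]
            exact mul_le_mul_of_nonneg_left (mul_le_mul_of_nonneg_right h₅ (hnonneg _)) hx
          _ ≤ _ := mul_le_mul_of_nonneg_left h₄ hx
      linarith
  have hall : ∀ S : Finset ι, 0 < weightOf W (N S) := by
    intro S
    induction S using Finset.induction with
    | empty => simpa [hN] using hpos
    | insert a S ha ih => exact (mul_pos hx' ih).trans_le (key S a ha)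
  by_contra! hcon
  have hempty : N Finset.univ = ∅ := by
    ext ω
    simpa [hN] using hcon ω
  have := hall Finset.univ
  simp [hempty, weightOf] at this

end Weight

/-! ### Product Bernoulli weights and independence -/

/-- The weight of `ω` when each coordinate is independently `true` with probability `p`. -/
noncomputable def bernoulliWeight {V : Type*} [Fintype V] (p : ℝ) (ω : V → Bool) : ℝ :=
  ∏ v, bif ω v then p else 1 - p

section Bernoulli

variable {V : Type*} [Fintype V] {p : ℝ}

theorem bernoulliWeight_nonneg (hp : 0 ≤ p) (hp1 : p ≤ 1) (ω : V → Bool) :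
    0 ≤ bernoulliWeight p ω :=
  Finset.prod_nonneg fun v _ => by cases ω v <;> simp [hp, hp1]

theorem sum_bernoulliWeight_mul_prod [DecidableEq V] (f : V → Bool → ℝ) :
    ∑ ω, bernoulliWeight p ω * ∏ v, f v (ω v) =
      ∏ v, (p * f v true + (1 - p) * f v false) := by
  have := Finset.prod_univ_sum (fun _ : V => (Finset.univ : Finset Bool))
    (fun v b => (bif b then p else 1 - p) * f v b)
  simp only [Fintype.piFinset_univ] at this
  simp only [bernoulliWeight, ← Finset.prod_mul_distrib, ← this]
  simp

theorem sum_bernoulliWeight_mul_prod_finset [DecidableEq V] (s : Finset V) (f : V → Bool → ℝ) :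
    ∑ ω, bernoulliWeight p ω * ∏ v ∈ s, f v (ω v) =
      ∏ v ∈ s, (p * f v true + (1 - p) * f v false) := by
  have := sum_bernoulliWeight_mul_prod (p := p) (fun v b => if v ∈ s then f v b else 1)
  simp only [Finset.prod_ite_mem, Finset.univ_inter] at this
  rw [this, ← Finset.prod_subset (Finset.subset_univ s)]
  · exact Finset.prod_congr rfl fun v hv => by simp [hv]
  · intro v _ hv
    simp [hv]

theorem sum_bernoulliWeight [DecidableEq V] :
    ∑ ω : V → Bool, bernoulliWeight p ω = 1 := by
  simpa using sum_bernoulliWeight_mul_prod_finset (V := V) (p := p) ∅ fun _ _ => 1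

/-- Events depending on disjoint sets of coordinates are independent. -/
theorem weightOf_bernoulliWeight_inter [DecidableEq V] (s : Finset V) {A B : Set (V → Bool)}
    (hA : ∀ ω ω', (∀ v ∈ s, ω v = ω' v) → (ω ∈ A ↔ ω' ∈ A))
    (hB : ∀ ω ω', (∀ v ∉ s, ω v = ω' v) → (ω ∈ B ↔ ω' ∈ B)) :
    weightOf (bernoulliWeight p) (A ∩ B) =
      weightOf (bernoulliWeight p) A * weightOf (bernoulliWeight p) B := by
  classical
  -- Two independent copies exchange their coordinates outside `s`. This preserves the product
  -- weight and turns `A ∩ B` for one copy into `A` for the first and `B` for the second.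
  let mix : (V → Bool) × (V → Bool) → (V → Bool) × (V → Bool) := fun q =>
    (fun v => if v ∈ s then q.1 v else q.2 v, fun v => if v ∈ s then q.2 v else q.1 v)
  have hmix : Function.Involutive mix := by
    rintro ⟨a, b⟩
    ext v <;> by_cases h : v ∈ s <;> simp [mix, h]
  have hw (q) : bernoulliWeight p (mix q).1 * bernoulliWeight p (mix q).2 =
      bernoulliWeight p q.1 * bernoulliWeight p q.2 := by
    simp only [bernoulliWeight, ← Finset.prod_mul_distrib]
    refine Finset.prod_congr rfl fun v _ => ?_
    by_cases h : v ∈ s <;> simp [mix, h, mul_comm]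
  have h₁ : weightOf (bernoulliWeight p) (A ∩ B) =
      ∑ q : (V → Bool) × (V → Bool),
        (A ∩ B).indicator (bernoulliWeight p) q.1 * bernoulliWeight p q.2 := by
    rw [Fintype.sum_prod_type, ← Fintype.sum_mul_sum, sum_bernoulliWeight, mul_one, weightOf]
  have h₂ : weightOf (bernoulliWeight p) A * weightOf (bernoulliWeight p) B =
      ∑ q : (V → Bool) × (V → Bool),
        A.indicator (bernoulliWeight p) q.1 * B.indicator (bernoulliWeight p) q.2 := by
    rw [Fintype.sum_prod_type, ← Fintype.sum_mul_sum, weightOf, weightOf]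
  rw [h₁, h₂]
  refine Fintype.sum_bijective mix hmix.bijective _ _ fun q => ?_
  have hA' : (mix q).1 ∈ A ↔ q.1 ∈ A := hA _ _ fun v hv => by simp [mix, hv]
  have hB' : (mix q).2 ∈ B ↔ q.1 ∈ B := hB _ _ fun v hv => by simp [mix, hv]
  by_cases ha : q.1 ∈ A <;> by_cases hb : q.1 ∈ B <;> simp [Set.indicator, hA', hB', ha, hb, hw q]

end Bernoulli

/-! ### Scalar estimates for the failure probabilities -/

theorem exp_one_mul_sq_add_one_le {d : ℕ} (hd : 9 ≤ d) :
    2.1 * (Real.exp 1 * ((d : ℝ) ^ 2 + 1)) ≤ 2 ^ d := by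
  suffices h : 5.75 * ((d : ℝ) ^ 2 + 1) ≤ 2 ^ d by
    nlinarith [Real.exp_one_lt_d9]
  induction d, hd using Nat.le_induction with
  | base => norm_num
  | succ n hn ih =>
    have hn' : (9 : ℝ) ≤ n := by exact_mod_cast hn
    rw [pow_succ 2]
    push_cast
    nlinarith

/-- The first two terms give `2 · 2^{-d}` and the last at most `0.1 · 2^{-d}`, which explains the
factor `2.1`. -/
theorem half_pow_add_half_pow_add_le {d : ℕ} (hd : 9 ≤ d) :
    (1 - 1 / 2 : ℝ) ^ d + (1 / 2) ^ d +
        1 / 2 * Real.exp (-(10 * d : ℕ) + 1 / 2 * (Real.exp 1 - 1) * d) ≤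
      1 / (Real.exp 1 * ((d : ℝ) ^ 2 + 1)) := by
  have hd' : (9 : ℝ) ≤ d := by exact_mod_cast hd
  have he := Real.exp_one_gt_d9
  have h₁ : Real.exp (-(10 * d : ℕ) + 1 / 2 * (Real.exp 1 - 1) * d) ≤ 0.2 * (1 / 2) ^ d := by
    calc _ ≤ Real.exp (-(2 : ℕ) + -d) := by
          refine Real.exp_le_exp.2 ?_
          push_cast
          nlinarith [Real.exp_one_lt_d9]
      _ = (Real.exp 1 ^ 2)⁻¹ * (1 / Real.exp 1) ^ d := by
          rw [Real.exp_add, Real.exp_neg, Real.exp_neg, one_div, inv_pow, Real.exp_one_pow,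
            Real.exp_one_pow]
      _ ≤ 0.2 * (1 / 2) ^ d := by
          gcongr
          · rw [inv_le_comm₀ (by positivity) (by norm_num)]
            nlinarith
          · linarith
  have h₂ : 2.1 * (1 / 2 : ℝ) ^ d ≤ 1 / (Real.exp 1 * ((d : ℝ) ^ 2 + 1)) := by
    rw [one_div_pow, mul_one_div, div_le_div_iff₀ (by positivity) (by positivity), one_mul]
    exact exp_one_mul_sq_add_one_le hd
  norm_num at *
  linarith

/-- The choice `x = 1/(D + 1)` in the local lemma, using `(1 + 1/D)^D ≤ e`. -/
theorem one_div_exp_one_mul_le (D : ℕ) :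
    1 / (Real.exp 1 * ((D : ℝ) + 1)) ≤ 1 / ((D : ℝ) + 1) * (1 - 1 / ((D : ℝ) + 1)) ^ D := by
  rcases Nat.eq_zero_or_pos D with rfl | hD
  · simpa using inv_le_one_of_one_le₀ (Real.one_le_exp zero_le_one)
  have hD' : (0 : ℝ) < D := by exact_mod_cast hD
  have h := Real.one_add_inv_pow_le_exp (n := D)
  have h₁ : 1 - 1 / ((D : ℝ) + 1) = (1 + (D : ℝ)⁻¹)⁻¹ := by field_simp; ring
  have h₂ : 1 / (Real.exp 1 * ((D : ℝ) + 1)) = 1 / ((D : ℝ) + 1) * (Real.exp 1)⁻¹ := by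
    field_simp
  rw [h₁, h₂, inv_pow]
  gcongr

/-- A sharpening of `1 - p ≤ exp (-p)`. -/
theorem Real.one_sub_le_exp_neg_sub_sq {p : ℝ} (hp : 0 ≤ p) (hp1 : p < 1) :
    1 - p ≤ Real.exp (-p - p ^ 2 / 2) := by
  have h := Real.hasSum_pow_div_log_of_abs_lt_one (x := p) (by rwa [abs_of_nonneg hp])
  have := h.summable.sum_le_tsum (Finset.range 2) fun i _ => by positivity
  rw [h.tsum_eq] at this
  norm_num [Finset.sum_range_succ] at this
  rw [← Real.log_le_iff_le_exp (by linarith)]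
  linarith

/-- The second-order term of `log (1 - p)` saves `1.35 p` relative to `e^{-pd}`; this pays for the
Chernoff term, relative size `p`, and for `p ^ d`, relative size at most `0.35 p`. The bound `0.368`
is just above `1/e`. -/
theorem one_sub_pow_add_pow_add_le {d : ℕ} {p : ℝ} (hd : 16 ≤ d) (hp : 0 ≤ p) (hp' : p ≤ 0.368)
    (hpd : 5 ≤ p * d) :
    (1 - p) ^ d + p ^ d + p * Real.exp (-(p * d)) ≤ Real.exp (-(p * d)) := by
  set E := Real.exp (-(p * d)) with hE
  have hE0 : 0 < E := Real.exp_pos _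
  have h₁ : (1 - p) ^ d ≤ E * (1 - 1.35 * p) := by
    calc (1 - p) ^ d ≤ Real.exp (-p - p ^ 2 / 2) ^ d :=
          pow_le_pow_left₀ (by linarith) (Real.one_sub_le_exp_neg_sub_sq hp (by linarith)) d
      _ = E * Real.exp (-(p * d / 2 * p)) := by
          rw [hE, ← Real.exp_nat_mul, ← Real.exp_add]; congr 1; ring
      _ ≤ E * Real.exp (-(2.5 * p)) := by gcongr; linarith
      _ ≤ E * (1 - 1.35 * p) := by
          gcongr
          have hb := Real.quadratic_le_exp_of_nonneg (x := 2.5 * p) (by positivity)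
          rw [Real.exp_neg, inv_le_comm₀ (Real.exp_pos _) (by linarith)]
          refine le_trans ?_ hb
          rw [inv_le_iff_one_le_mul₀ (by linarith)]
          nlinarith [mul_nonneg hp hp, mul_nonneg (mul_nonneg hp hp) hp]
  have h₂ : p ^ d ≤ E * (0.35 * p) := by
    have hexp : Real.exp p ≤ 1.6 := by
      have := Real.exp_bound_div_one_sub_of_interval hp (by linarith)
      refine this.trans ?_
      rw [div_le_iff₀ (by linarith)]
      linarith
    have hsplit : p ^ d = E * (p * Real.exp p) ^ d := by
      rw [mul_pow, ← Real.exp_nat_mul, hE, mul_left_comm, ← Real.exp_add, mul_comm p]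
      simp
    rw [hsplit]
    gcongr
    calc (p * Real.exp p) ^ d ≤ (1.6 * p) ^ d := by
          have : p * Real.exp p ≤ 1.6 * p := by nlinarith
          gcongr
      _ = (1.6 * p) ^ (d - 1) * (1.6 * p) := by
          rw [← pow_succ, Nat.sub_add_cancel (by omega)]
      _ ≤ (1.6 * p) ^ 15 * (1.6 * p) := by
          have : 1.6 * p ≤ 1 := by linarith
          have := pow_le_pow_of_le_one (by positivity) this (show 15 ≤ d - 1 by omega)
          gcongr
      _ ≤ 0.6 ^ 15 * (1.6 * p) := by
          gcongr
          linarith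
      _ ≤ 0.35 * p := by
          rw [← mul_assoc]
          gcongr
          norm_num
  nlinarith

/-! ### Probabilities of the bad events -/

section Bernoulli

variable {V : Type*} [Fintype V] [DecidableEq V] {p : ℝ}

theorem weightOf_bernoulliWeight_forall_eq (hp : 0 ≤ p) (hp1 : p ≤ 1) (s : Finset V) (b : Bool) :
    weightOf (bernoulliWeight p) {ω | ∀ u ∈ s, ω u = b} ≤ (bif b then p else 1 - p) ^ s.card := by
  refine (weightOf_le_sum_mul (bernoulliWeight_nonneg hp hp1)
    (f := fun ω => ∏ u ∈ s, if ω u = b then 1 else 0) (fun ω => ?_) fun ω hω => ?_).trans ?_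
  · exact Finset.prod_nonneg fun u _ => by split_ifs <;> norm_num
  · rw [Finset.prod_congr rfl fun u hu => if_pos (hω u hu)]
    simp
  · rw [sum_bernoulliWeight_mul_prod_finset s fun _ c => if c = b then 1 else 0]
    cases b <;> simp

/-- A Chernoff bound, for the exponential moment with parameter `1`. -/
theorem weightOf_bernoulliWeight_le_card (hp : 0 ≤ p) (hp1 : p ≤ 1) {s : Finset V} {v : V}
    (hv : v ∉ s) (k : ℕ) :
    weightOf (bernoulliWeight p) {ω | ω v = true ∧ k ≤ (s.filter fun u => ω u = true).card} ≤
      p * Real.exp (-k + p * (Real.exp 1 - 1) * s.card) := by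
  -- Markov's inequality is applied to `1[ω v] · e^{X - k}`, where `X` counts the true coordinates
  -- in `s`; since `v ∉ s`, the first factor contributes exactly `p`.
  set f : V → Bool → ℝ := fun u c =>
    if u = v then (bif c then 1 else 0) else (bif c then Real.exp 1 else 1) with hf
  have hf0 (u c) : 0 ≤ f u c := by
    simp only [hf]
    split_ifs <;> cases c <;> simp [Real.exp_nonneg]
  have hprod (g : V → ℝ) : ∏ u ∈ insert v s, g u = g v * ∏ u ∈ s, g u :=
    Finset.prod_insert hv
  have hne {u : V} (hu : u ∈ s) : u ≠ v := fun h => hv (h ▸ hu)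
  refine (weightOf_le_sum_mul (bernoulliWeight_nonneg hp hp1)
    (f := fun ω => (∏ u ∈ insert v s, f u (ω u)) * Real.exp (-k)) (fun ω => ?_)
    fun ω hω => ?_).trans ?_
  · exact mul_nonneg (Finset.prod_nonneg fun u _ => hf0 u _) (Real.exp_nonneg _)
  · have h₁ : ∏ u ∈ s, f u (ω u) = Real.exp 1 ^ (s.filter fun u => ω u = true).card := by
      rw [← Finset.prod_const, Finset.prod_filter]
      exact Finset.prod_congr rfl fun u hu => by cases h : ω u <;> simp [hf, hne hu]
    have h₂ : f v (ω v) = 1 := by simp [hf, hω.1]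
    rw [hprod, h₁, h₂, one_mul, Real.exp_one_pow, ← Real.exp_add]
    apply Real.one_le_exp
    have : (k : ℝ) ≤ (s.filter fun u => ω u = true).card := by exact_mod_cast hω.2
    linarith
  · simp only [← mul_assoc, ← Finset.sum_mul]
    rw [sum_bernoulliWeight_mul_prod_finset, hprod]
    have h₁ : ∏ u ∈ s, (p * f u true + (1 - p) * f u false) =
        (p * (Real.exp 1 - 1) + 1) ^ s.card := by
      rw [← Finset.prod_const]
      refine Finset.prod_congr rfl fun u hu => ?_
      simp only [hf, if_neg (hne (by assumption)), cond_true, cond_false]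
      ring
    have h₂ : p * f v true + (1 - p) * f v false = p := by simp [hf]
    rw [h₁, h₂, add_comm (-(k : ℝ)), Real.exp_add, mul_assoc, mul_comm _ (s.card : ℝ),
      Real.exp_nat_mul]
    have : 0 ≤ p * (Real.exp 1 - 1) := by nlinarith [Real.exp_one_gt_d9]
    gcongr
    exact Real.add_one_le_exp _

end Bernoulli

/-! ### Deterministic recoloring -/

namespace SimpleGraph

variable {V : Type*} {G : SimpleGraph V} [G.LocallyFinite]

theorem IsRegularOfDegree.coloring_isDynamic_two {α : Type*} [DecidableEq α] {d : ℕ}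
    (hG : G.IsRegularOfDegree d) (hd : d ≤ 1) (C : G.Coloring α) : C.IsDynamic 2 := by
  intro v
  rw [hG v, min_eq_right (by omega)]
  interval_cases d
  · simp
  · have : 0 < (G.neighborFinset v).card := by rw [card_neighborFinset_eq_degree, hG v]; simp
    exact Finset.card_pos.2 ((Finset.card_pos.1 this).image _)

theorem Coloring.isDynamic_two_of_forall_exists {α : Type*} [DecidableEq α] (C : G.Coloring α)
    (h : ∀ v, ∃ u w, G.Adj v u ∧ G.Adj v w ∧ C u ≠ C w) : C.IsDynamic 2 := by
  intro v
  obtain ⟨u, w, hu, hw, hne⟩ := h v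
  refine (min_le_left _ _).trans (Finset.one_lt_card.2 ⟨C u, ?_, C w, ?_, hne⟩)
  · exact Finset.mem_image_of_mem _ (by simpa)
  · exact Finset.mem_image_of_mem _ (by simpa)

theorem dynamicChromaticNumber_le_of_dynamicColorable {r k : ℕ} (h : G.DynamicColorable r k) :
    G.dynamicChromaticNumber r ≤ k :=
  iInf₂_le k h

/-- With `2 * d + 1` colors one can recolor a neighbor of each vertex in turn. -/
theorem IsRegularOfDegree.dynamicColorable_two_of_colorable [Finite V] {d m : ℕ}
    (hG : G.IsRegularOfDegree d) (hd : 2 ≤ d) (hm : 2 * d < m) (hC : G.Colorable m) :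
    G.DynamicColorable 2 m := by
  classical
  have := Fintype.ofFinite V
  suffices h : ∀ S : Finset V, ∃ C : G.Coloring (Fin m),
      ∀ v ∈ S, ∃ u w, G.Adj v u ∧ G.Adj v w ∧ C u ≠ C w by
    obtain ⟨C, hC⟩ := h Finset.univ
    exact ⟨C, C.isDynamic_two_of_forall_exists fun v => hC v (Finset.mem_univ v)⟩
  intro S
  induction S using Finset.induction with
  | empty => exact ⟨hC.some, by simp⟩
  | insert v S hv ih =>
    obtain ⟨C, hC⟩ := ih
    have hcard (w) : (G.neighborFinset w).card = d := by
      rw [card_neighborFinset_eq_degree, hG w]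
    obtain ⟨u, hu⟩ : (G.neighborFinset v).Nonempty := by
      rw [← Finset.card_pos, hcard]; omega
    rw [mem_neighborFinset] at hu
    -- Each `w` gets a witness neighbor whose color survives the recoloring of `u`.
    have hother (w : V) : ∃ y, G.Adj w y ∧ y ≠ u := by
      obtain ⟨y, hy, hne⟩ := Finset.exists_mem_ne (s := G.neighborFinset w)
        (by rw [hcard]; omega) u
      exact ⟨y, by simpa using hy, hne⟩
    choose y hy hyu using hother
    -- At most `d` colors are excluded for properness and `d` more so that each neighbor `w` of `u`
    -- sees both `x` and the color of `y w`. Vertices not adjacent to `u` see no change.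
    obtain ⟨x, hx⟩ : ∃ x, x ∉ (G.neighborFinset u).image C ∪
        (G.neighborFinset u).image fun w => C (y w) := by
      by_contra! hall
      have h₁ := Finset.card_le_card (fun x _ => hall x : Finset.univ ⊆ _)
      have h₂ := h₁.trans (Finset.card_union_le _ _)
      have h₃ := Finset.card_image_le (s := G.neighborFinset u) (f := C)
      have h₄ := Finset.card_image_le (s := G.neighborFinset u) (f := fun w => C (y w))
      rw [hcard] at h₃ h₄
      rw [Finset.card_univ, Fintype.card_fin] at h₂
      omega
    simp only [Finset.mem_union, Finset.mem_image, mem_neighborFinset, not_or, not_exists,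
      not_and] at hx
    obtain ⟨hx₁, hx₂⟩ := hx
    let C' : G.Coloring (Fin m) := Coloring.mk (Function.update C u x) fun {a b} hab => by
      by_cases ha : a = u
      · subst ha
        rw [Function.update_self, Function.update_of_ne hab.ne']
        exact fun h => hx₁ b hab h.symm
      · rw [Function.update_of_ne ha]
        by_cases hb : b = u
        · subst hb
          rw [Function.update_self]
          exact hx₁ a hab.symm
        · rw [Function.update_of_ne hb]
          exact C.valid hab
    have hC'u : C' u = x := Function.update_self (f := C) ..
    have hC' {a : V} (ha : a ≠ u) : C' a = C a := Function.update_of_ne (f := C) ha ..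
    refine ⟨C', fun w hw => ?_⟩
    by_cases hwu : G.Adj u w
    · exact ⟨u, y w, hwu.symm, hy w, by
        rw [hC'u, hC' (hyu w)]
        exact fun h => hx₂ w hwu h.symm⟩
    · have hwS : w ∈ S := by
        rcases Finset.mem_insert.1 hw with rfl | h
        · exact absurd hu.symm hwu
        · exact h
      obtain ⟨a, b, ha, hb, hne⟩ := hC w hwS
      refine ⟨a, b, ha, hb, ?_⟩
      rwa [hC', hC']
      · rintro rfl; exact hwu hb.symm
      · rintro rfl; exact hwu ha.symm

/-- Greedy coloring of the subgraph induced on `T`. -/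
theorem exists_partial_coloring [DecidableEq V] {T : Finset V} {k : ℕ} (hk : 0 < k)
    (h : ∀ v ∈ T, ((G.neighborFinset v).filter (· ∈ T)).card < k) :
    ∃ c : V → Fin k, ∀ u ∈ T, ∀ v ∈ T, G.Adj u v → c u ≠ c v := by
  suffices hS : ∀ S ⊆ T, ∃ c : V → Fin k, ∀ u ∈ S, ∀ v ∈ S, G.Adj u v → c u ≠ c v from
    hS T subset_rfl
  intro S
  induction S using Finset.induction with
  | empty => exact fun _ => ⟨fun _ => ⟨0, hk⟩, by simp⟩
  | insert a S ha ih =>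
    intro hS
    obtain ⟨c, hc⟩ := ih ((Finset.subset_insert _ _).trans hS)
    obtain ⟨x, hx⟩ : ∃ x, x ∉ ((G.neighborFinset a).filter (· ∈ T)).image c := by
      by_contra! hall
      have h₁ := Finset.card_le_card (fun x _ => hall x : Finset.univ ⊆ _)
      have h₂ := h₁.trans Finset.card_image_le
      rw [Finset.card_univ, Fintype.card_fin] at h₂
      exact absurd (h a (hS (Finset.mem_insert_self _ _))) (by omega)
    have hx' (b) (hb : b ∈ S) (hab : G.Adj a b) : c b ≠ x := fun hbx =>
      hx (Finset.mem_image.2 ⟨b, by simp [hab, hS (Finset.mem_insert_of_mem hb)], hbx⟩)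
    have hne {b} (hb : b ∈ S) : b ≠ a := fun h => ha (h ▸ hb)
    refine ⟨Function.update c a x, fun u hu v hv huv => ?_⟩
    rcases Finset.mem_insert.1 hu with rfl | hu
    · have hv := (Finset.mem_insert.1 hv).resolve_left huv.ne'
      rw [Function.update_self, Function.update_of_ne (hne hv)]
      exact (hx' v hv huv).symm
    · rw [Function.update_of_ne (hne (by assumption))]
      rcases Finset.mem_insert.1 hv with rfl | hv
      · rw [Function.update_self]
        exact hx' u (by assumption) huv.symm
      · rw [Function.update_of_ne (hne hv)]
        exact hc u (by assumption) v (by assumption) huv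

/-- Recoloring a set `T` with `k` new colors, when `T` splits every neighborhood and induces a
subgraph of maximum degree less than `k`. -/
theorem dynamicColorable_two_add [DecidableEq V] {n k : ℕ} (hC : G.Colorable n) (hk : 0 < k)
    (T : Finset V)
    (hmem : ∀ v, ∃ u, G.Adj v u ∧ u ∈ T) (hnot : ∀ v, ∃ u, G.Adj v u ∧ u ∉ T)
    (hT : ∀ v ∈ T, ((G.neighborFinset v).filter (· ∈ T)).card < k) :
    G.DynamicColorable 2 (n + k) := by
  obtain ⟨c, hc⟩ := exists_partial_coloring hk hT
  have C := hC.some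
  have hlr (i : Fin n) (j : Fin k) : Fin.castAdd k i ≠ Fin.natAdd n j := by
    simp only [ne_eq, Fin.ext_iff, Fin.val_castAdd, Fin.val_natAdd]
    omega
  let C' : G.Coloring (Fin (n + k)) := Coloring.mk
    (fun v => if v ∈ T then Fin.natAdd n (c v) else Fin.castAdd k (C v)) fun {a b} hab => by
      by_cases ha : a ∈ T <;> by_cases hb : b ∈ T <;> simp only [ha, hb, if_true, if_false]
      · exact fun h => hc a ha b hb hab (Fin.natAdd_injective _ _ h)
      · exact (hlr _ _).symm
      · exact hlr _ _
      · exact fun h => C.valid hab (Fin.castAdd_injective _ _ h)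
  refine ⟨C', C'.isDynamic_two_of_forall_exists fun v => ?_⟩
  obtain ⟨u, hu, huT⟩ := hmem v
  obtain ⟨w, hw, hwT⟩ := hnot v
  refine ⟨u, w, hu, hw, ?_⟩
  change (if u ∈ T then Fin.natAdd n (c u) else _) ≠ (if w ∈ T then _ else Fin.castAdd k (C w))
  rw [if_pos huT, if_neg hwT]
  exact (hlr _ _).symm

end SimpleGraph

/-! ### The random splitting set -/

namespace SimpleGraph

variable {V : Type*} {G : SimpleGraph V} [G.LocallyFinite]

/-- The number of vertices at distance one or two from `v`. -/
theorem IsRegularOfDegree.card_biUnion_le [DecidableEq V] {d : ℕ} (hG : G.IsRegularOfDegree d)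
    (v : V) :
    ((G.neighborFinset v).biUnion fun w => (insert w (G.neighborFinset w)).erase v).card ≤
      d ^ 2 := by
  have hcard (w) : (G.neighborFinset w).card = d := by
    rw [card_neighborFinset_eq_degree, hG w]
  refine (Finset.card_biUnion_le_card_mul _ _ d fun w hw => ?_).trans (by rw [hcard, sq])
  rw [mem_neighborFinset] at hw
  rw [Finset.card_erase_of_mem (by simp [hw.symm]), Finset.card_insert_of_notMem (by simp), hcard]
  rfl

/-- The three summands of the hypothesis bound the chances that the neighborhood of `v` misses `T`,
lies inside `T`, or that `v ∈ T` has at least `k` neighbors in `T`. Their union is one bad event per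
vertex. -/
theorem IsRegularOfDegree.exists_splitting_finset [Fintype V] [DecidableEq V] {d k : ℕ} {p : ℝ}
    (hG : G.IsRegularOfDegree d) (hd : 0 < d) (hp : 0 ≤ p) (hp1 : p ≤ 1)
    (h : (1 - p) ^ d + p ^ d + p * Real.exp (-k + p * (Real.exp 1 - 1) * d) ≤
      1 / (Real.exp 1 * ((d : ℝ) ^ 2 + 1))) :
    ∃ T : Finset V, (∀ v, ∃ u, G.Adj v u ∧ u ∈ T) ∧ (∀ v, ∃ u, G.Adj v u ∧ u ∉ T) ∧
      ∀ v ∈ T, ((G.neighborFinset v).filter (· ∈ T)).card < k := by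
  have hW := bernoulliWeight_nonneg (V := V) hp hp1
  have hcard (w) : (G.neighborFinset w).card = d := by
    rw [card_neighborFinset_eq_degree, hG w]
  let E (v : V) (b : Bool) : Set (V → Bool) := {ω | ∀ u ∈ G.neighborFinset v, ω u = b}
  let F (v : V) : Set (V → Bool) :=
    {ω | ω v = true ∧ k ≤ ((G.neighborFinset v).filter fun u => ω u = true).card}
  let A (v : V) : Set (V → Bool) := E v false ∪ E v true ∪ F v
  let N (v : V) : Finset V := insert v (G.neighborFinset v)
  have hA (v : V) : weightOf (bernoulliWeight p) (A v) ≤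
      1 / (((d ^ 2 : ℕ) : ℝ) + 1) * (1 - 1 / (((d ^ 2 : ℕ) : ℝ) + 1)) ^ (d ^ 2) := by
    refine le_trans ?_ (one_div_exp_one_mul_le (d ^ 2))
    push_cast
    refine le_trans ?_ h
    refine (weightOf_union_le hW _ _).trans
      (add_le_add ((weightOf_union_le hW _ _).trans (add_le_add ?_ ?_)) ?_)
    · simpa only [hcard, cond_true, cond_false] using
        weightOf_bernoulliWeight_forall_eq hp hp1 (G.neighborFinset v) false
    · simpa only [hcard, cond_true, cond_false] using
        weightOf_bernoulliWeight_forall_eq hp hp1 (G.neighborFinset v) true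
    · simpa only [hcard] using weightOf_bernoulliWeight_le_card hp hp1 (v := v)
        (s := G.neighborFinset v) (by simp) k
  have hlocal (v : V) (ω ω' : V → Bool) (hω : ∀ u ∈ N v, ω u = ω' u) : ω ∈ A v ↔ ω' ∈ A v := by
    have hv : ω v = ω' v := hω v (by simp [N])
    have hn (u) (hu : u ∈ G.neighborFinset v) : ω u = ω' u := hω u (by simp [N] at hu ⊢; simp [hu])
    have hE (b) : ω ∈ E v b ↔ ω' ∈ E v b :=
      forall₂_congr fun u hu => by rw [hn u hu]
    have hF : ω ∈ F v ↔ ω' ∈ F v := by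
      simp only [F, Set.mem_ofPred_eq, hv]
      rw [Finset.filter_congr fun u hu => by rw [hn u hu]]
    simp only [A, Set.mem_union, hE, hF]
  obtain ⟨ω, hω⟩ := exists_forall_notMem_of_local_lemma (W := bernoulliWeight p) hW
    (by simp [weightOf, sum_bernoulliWeight]) A
    (fun v => (G.neighborFinset v).biUnion fun w => (N w).erase v)
    (x := 1 / (((d ^ 2 : ℕ) : ℝ) + 1)) (by positivity)
    (by
      rw [div_lt_one (by positivity)]
      have : 0 < ((d ^ 2 : ℕ) : ℝ) := by positivity
      linarith)
    hG.card_biUnion_le hA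
    fun v S hv hS => by
      refine (weightOf_bernoulliWeight_inter (N v) (hlocal v) fun ω ω' hω => ?_).le
      -- A coordinate shared by `N v` and `N j` would put `j` within distance two of `v`, hence in
      -- the dependency set.
      refine forall₂_congr fun j hj => not_congr (hlocal j ω ω' fun u hu => hω u fun huv => ?_)
      have hjv : j ≠ v := fun h => hv (h ▸ hj)
      refine Finset.disjoint_left.1 hS hj (Finset.mem_biUnion.2 ?_)
      simp only [N, Finset.mem_insert, mem_neighborFinset, Finset.mem_erase] at hu huv ⊢
      rcases huv with rfl | huv
      · exact ⟨j, (hu.resolve_left hjv.symm).symm, hjv, Or.inl rfl⟩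
      · refine ⟨u, huv, hjv, ?_⟩
        rcases hu with rfl | hu
        · exact Or.inl rfl
        · exact Or.inr hu.symm
  refine ⟨Finset.univ.filter fun v => ω v = true, fun v => ?_, fun v => ?_, fun v hv => ?_⟩
  · by_contra! hcon
    exact hω v (Or.inl (Or.inl fun u hu => by simpa using hcon u (by simpa using hu)))
  · by_contra! hcon
    exact hω v (Or.inl (Or.inr fun u hu => by simpa using hcon u (by simpa using hu)))
  · by_contra! hcon
    exact hω v (Or.inr ⟨by simpa using hv, by simpa using hcon⟩)

theorem IsRegularOfDegree.dynamicColorable_two_add {V : Type*} [Finite V] {G : SimpleGraph V}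
    [G.LocallyFinite] {d k n : ℕ} (hG : G.IsRegularOfDegree d) (hd : 9 ≤ d)
    (hk : Real.exp 1 * Real.log ((d : ℝ) ^ 2 + 1) + Real.exp 1 ≤ k) (hC : G.Colorable n) :
    G.DynamicColorable 2 (n + k) := by
  classical
  have := Fintype.ofFinite V
  have he := Real.exp_pos 1
  have he₁ := Real.exp_one_gt_d9
  have hd' : (9 : ℝ) ≤ d := by exact_mod_cast hd
  -- This yields `k / e ≥ 5`, since `5e < 14`, and `d ≥ 16` when `k < d`.
  have hk14 : (14 : ℝ) < k := by
    refine lt_of_lt_of_le ?_ hk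
    have := le_exp_one_mul_log_of_pow_le (n := 82) (a := 13) (b := 3) (by norm_num) (by norm_num)
      (by norm_num)
    have hlog : Real.log (82 : ℕ) ≤ Real.log ((d : ℝ) ^ 2 + 1) :=
      Real.log_le_log (by norm_num) (by push_cast; nlinarith)
    have := mul_le_mul_of_nonneg_left hlog he.le
    norm_num at *
    linarith
  have hk0 : 0 < k := by
    have : (0 : ℝ) < k := by linarith
    exact_mod_cast this
  rcases le_or_gt d k with hdk | hkd
  -- The threshold `10 * d` only makes the Chernoff term negligible. The degree bound comes from
  -- `h₂`: some neighbor lies outside `T`, so fewer than `d ≤ k` lie inside.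
  · obtain ⟨T, h₁, h₂, h₃⟩ := hG.exists_splitting_finset (k := 10 * d) (p := 1 / 2) (by omega)
      (by norm_num) (by norm_num) (half_pow_add_half_pow_add_le hd)
    refine SimpleGraph.dynamicColorable_two_add hC hk0 T h₁ h₂ fun v _ => ?_
    obtain ⟨u, hu, huT⟩ := h₂ v
    calc _ < (G.neighborFinset v).card :=
          Finset.card_lt_card (Finset.filter_ssubset.2 ⟨u, by simpa using hu, huT⟩)
      _ ≤ k := by rwa [card_neighborFinset_eq_degree, hG v]
  · have hd16 : 16 ≤ d := by
      have : 14 < k := by exact_mod_cast hk14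
      omega
    have hkd' : (k : ℝ) < d := by exact_mod_cast hkd
    have hpd : k / (Real.exp 1 * d) * d = k / Real.exp 1 := by field_simp
    obtain ⟨T, h₁, h₂, h₃⟩ := hG.exists_splitting_finset (k := k) (p := k / (Real.exp 1 * d))
      (by omega) (by positivity) (by
        rw [div_le_one (by positivity)]
        nlinarith) (by
        have hmain := one_sub_pow_add_pow_add_le (d := d) (p := k / (Real.exp 1 * d)) hd16
          (by positivity)
          (by
            rw [div_le_iff₀ (by positivity)]
            nlinarith)
          (by
            rw [hpd, le_div_iff₀ he]
            linarith [Real.exp_one_lt_d9])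
        have hexp : -(k : ℝ) + k / (Real.exp 1 * d) * (Real.exp 1 - 1) * d =
            -(k / (Real.exp 1 * d) * d) := by
          field_simp
          ring
        rw [hexp]
        refine hmain.trans ?_
        rw [hpd, one_div, Real.exp_neg]
        apply inv_anti₀ (by positivity)
        rw [← Real.log_le_iff_le_exp (by positivity), Real.log_mul he.ne' (by positivity),
          Real.log_exp, le_div_iff₀ he]
        linarith)
    exact SimpleGraph.dynamicColorable_two_add hC hk0 T h₁ h₂ h₃

end SimpleGraph

/-! ### Assembly by the size of the degree -/

theorem mainTheorem1 {V : Type*} [Finite V] (G : SimpleGraph V) [G.LocallyFinite] (d : ℕ)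
    (hG : G.IsRegularOfDegree d) :
    G.dynamicChromaticNumber 2 ≤
        G.chromaticNumber +
          (⌈Real.exp 1 * Real.log ((d : ℝ) ^ 2 + 1) + Real.exp 1⌉₊ : ℕ∞) ∧
      (3 ≤ d →
        ⌈Real.exp 1 * Real.log ((d : ℝ) ^ 2 + 1) + Real.exp 1⌉₊ ≤
            ⌈(5.437 : ℝ) * Real.log d + 2.721⌉₊ ∧
          G.dynamicChromaticNumber 2 ≤
            G.chromaticNumber + (⌈(5.437 : ℝ) * Real.log d + 2.721⌉₊ : ℕ∞) ∧
          (⌈(5.437 : ℝ) * Real.log d + 2.721⌉₊ : ℝ) < 14.06 * Real.log d + 1) := by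
  suffices h : G.dynamicChromaticNumber 2 ≤ G.chromaticNumber +
      (⌈Real.exp 1 * Real.log ((d : ℝ) ^ 2 + 1) + Real.exp 1⌉₊ : ℕ∞) by
    refine ⟨h, fun hd => ⟨ceil_exp_one_mul_log_le hd, h.trans ?_, ceil_mul_log_lt hd⟩⟩
    exact add_le_add_right (Nat.cast_le.2 (ceil_exp_one_mul_log_le hd)) _
  obtain ⟨n, hn⟩ := ENat.ne_top_iff_exists.1
    (SimpleGraph.chromaticNumber_ne_top_iff_exists.2 ⟨_, G.colorable_chromaticNumber_of_fintype⟩)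
  have hC : G.Colorable n := SimpleGraph.chromaticNumber_le_iff_colorable.1 hn.ge
  rw [← hn]
  rcases le_or_gt d 1 with h1 | h1
  · exact (SimpleGraph.dynamicChromaticNumber_le_of_dynamicColorable
      ⟨hC.some, hG.coloring_isDynamic_two h1 _⟩).trans le_self_add
  · refine (SimpleGraph.dynamicChromaticNumber_le_of_dynamicColorable (k := n + _) ?_).trans
      (by push_cast; rfl)
    rcases le_or_gt d 8 with h8 | h8
    -- An edge is needed for `χ ≥ 2`, so the empty graph is treated apart.
    · rcases isEmpty_or_nonempty V with hV | ⟨⟨v⟩⟩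
      · exact ⟨SimpleGraph.Coloring.mk isEmptyElim fun {v} => isEmptyElim v, isEmptyElim⟩
      obtain ⟨u, hu⟩ := (G.degree_pos_iff_exists_adj v).1 (by rw [hG v]; omega)
      have hn2 := SimpleGraph.two_le_chromaticNumber_of_adj hu
      rw [← hn] at hn2
      have hn2 : 2 ≤ n := by exact_mod_cast hn2
      have hk := two_mul_le_ceil_add_one h1 h8
      exact hG.dynamicColorable_two_of_colorable h1 (by omega) (hC.mono le_self_add)
    · exact hG.dynamicColorable_two_add h8 (Nat.le_ceil _) hC
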